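/- Setting. There are $K$ arms with known costs $c_1\le\dots\le c_K$ and a subsidy factor $\alpha\in[0,1)$. Let $\mathcal M$ be a family of probability distributions on $\mathbb R$ with finite mean. An instance $\nu=(\nu_1,\dots,\nu_K)$ assigns to each arm $a_i$ a reward distribution $\nu_i\in\mathcal M$, with mean $\mu_i$; put $\mu^*=\max_i\mu_i$. An arm $a_i$ is feasible if $\mu_i\ge(1-\alpha)\mu^*$, and $a^*$ denotes the cheapest feasible arm (the one of least index if several feasible arms have the least cost); an arm $a_k$ is expensive if $k>a^*$. In each round a policy chooses, possibly at random, an arm on the basis of the arms and rewards of the previous rounds, and observes a reward drawn from the distribution of that arm; the policy may depend on the horizon $T$. Let $\mathbb E_\nu[n_i(T)]$ be the expected number of pulls of $a_i$ in the first $T$ rounds, under the policy for horizon $T$. The policy is consistent for $\mathcal M$ if, for every instance $\nu$ with distributions in $\mathcal M$ that has a feasible arm, for every $i\ne a^*$ and every $0<\gamma\le 1$, $\mathbb E_\nu[n_i(T)]=o(T^\gamma)$ as $T\to\infty$. For $P\in\mathcal M$ and $x\in\mathbb R$ let $$D_{\inf}(P,x)=\inf\{\mathrm{KL}(P,Q)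 : Q\in\mathcal M,\ \mathbb E[Q]>x\}\in[0,\infty],$$ with $\inf\emptyset=\infty$. Conventions: $1/\infty=0$, and a positive number divided by $0$ is $\infty$. Theorem. For every policy that is consistent for $\mathcal M$, every instance $\nu$ with distributions in $\mathcal M$ that has a feasible arm, and every expensive arm $a_k$ of $\nu$, $$\liminf_{T\to\infty}\frac{\mathbb E_\nu[n_k(T)]}{\log T}\ \ge\ \frac1{D_{\inf}\!\left(\nu_k,\ \mu_{a^*}/(1-\alpha)\right)} .$$ If $\mathcal M$ is the family of all Gaussian distributions with unit variance, the right-hand side equals $\dfrac{2(1-\alpha)^2}{(\mu_{a^*}-(1-\alpha)\mu_k)^2}$, so that $$\liminf_{T\to\infty}\frac{\mathbb E_\nu[n_k(T)]}{\log T}\ \ge\ \frac{2(1-\alpha)^2}{\left(\mu_{a^*}-(1-\alpha)\mu_k\right)^2} .$$ -/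

import Mathlib

open MeasureTheory ProbabilityTheory Filter Asymptotics
open scoped ENNReal

noncomputable section

namespace CostSubsidy

/-- A history of `t` rounds with `K` arms: the arm pulled and the reward observed, round by round. -/
abbrev History (K t : ℕ) : Type := Fin t → Fin K × ℝ

/-- A (possibly randomized) policy: given the history of the first `t` rounds, `rule t` is the
conditional distribution of the arm pulled in the next round. -/
structure Policy (K : ℕ) where
  rule : ∀ t : ℕ, Kernel (History K t) (Fin K)
  isMarkov : ∀ t : ℕ, IsMarkovKernel (rule t)

attribute [instance] Policy.isMarkov

/-- A bandit instance with `K` arms: the reward distribution of each arm. -/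
abbrev Instance (K : ℕ) : Type := Fin K → ProbabilityMeasure ℝ

/-- The kernel sending an arm to its reward distribution. -/
def rewardKernel {K : ℕ} (ν : Instance K) : Kernel (Fin K) ℝ :=
  Kernel.ofFunOfCountable fun a => (ν a : Measure ℝ)

instance {K : ℕ} (ν : Instance K) : IsMarkovKernel (rewardKernel ν) :=
  ⟨fun a => inferInstanceAs (IsProbabilityMeasure (ν a : Measure ℝ))⟩

/-- One round: draw the arm from the policy, then the reward from the distribution of that arm,
which depends on the past only through the arm. -/
def roundKernel {K : ℕ} (π : Policy K) (ν : Instance K) (t : ℕ) :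
    Kernel (History K t) (Fin K × ℝ) :=
  (π.rule t) ⊗ₖ ((rewardKernel ν).prodMkLeft (History K t))

instance {K : ℕ} (π : Policy K) (ν : Instance K) (t : ℕ) :
    IsMarkovKernel (roundKernel π ν t) := by
  unfold roundKernel; infer_instance

/-- Append one round to a history. -/
def History.extend {K t : ℕ} (p : History K t × (Fin K × ℝ)) : History K (t + 1) :=
  Fin.snoc (α := fun _ => Fin K × ℝ) p.1 p.2

theorem History.measurable_extend {K t : ℕ} :
    Measurable (History.extend : History K t × (Fin K × ℝ) → History K (t + 1)) := by
  refine measurable_pi_lambda _ fun i => ?_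
  refine Fin.lastCases ?_ (fun j => ?_) i
  · simpa [History.extend] using measurable_snd
  · simpa [History.extend, Function.comp_def] using
      (measurable_pi_apply (X := fun _ : Fin t => Fin K × ℝ) j).comp
        (measurable_fst (α := History K t) (β := Fin K × ℝ))

/-- The law of the history of the first `t` rounds when `π` interacts with `ν`. -/
def historyLaw {K : ℕ} (π : Policy K) (ν : Instance K) : ∀ t : ℕ, Measure (History K t)
  | 0 => Measure.dirac Fin.elim0
  | t + 1 => ((historyLaw π ν t) ⊗ₘ (roundKernel π ν t)).map History.extend

instance {K : ℕ} (π : Policy K) (ν : Instance K) (t : ℕ) :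
    IsProbabilityMeasure (historyLaw π ν t) := by
  induction t with
  | zero => unfold historyLaw; infer_instance
  | succ t ih =>
    unfold historyLaw
    exact Measure.isProbabilityMeasure_map History.measurable_extend.aemeasurable

/-- The number of pulls of arm `k` in a history. -/
def pulls {K t : ℕ} (k : Fin K) (h : History K t) : ℕ :=
  (Finset.univ.filter fun s : Fin t => (h s).1 = k).card

/-- The expected number of pulls of arm `k` in the first `T` rounds. -/
def expectedPulls {K : ℕ} (π : Policy K) (ν : Instance K) (k : Fin K) (T : ℕ) : ℝ :=
  ∫ h, (pulls k h : ℝ) ∂(historyLaw π ν T)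

/-- The mean of a reward distribution. -/
def mean (P : ProbabilityMeasure ℝ) : ℝ := ∫ x, x ∂(P : Measure ℝ)

/-- The best mean reward of an instance. -/
def bestMean {K : ℕ} (ν : Instance K) : ℝ := ⨆ i, mean (ν i)

/-- An arm is feasible if its mean reaches the fraction `1 - α` of the best mean. -/
def IsFeasible {K : ℕ} (α : ℝ) (ν : Instance K) (i : Fin K) : Prop :=
  (1 - α) * bestMean ν ≤ mean (ν i)

/-- The optimal arm is the cheapest feasible arm, the one of least index if several feasible arms
have the least cost. -/
def IsOptimalArm {K : ℕ} (α : ℝ) (c : Fin K → ℝ) (ν : Instance K) (a : Fin K) : Prop :=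
  IsFeasible α ν a ∧ ∀ j, IsFeasible α ν j → c a ≤ c j ∧ (c j = c a → a ≤ j)

/-- A policy is consistent for the family `M` if, on every instance with reward distributions in
`M` (and an optimal arm), each other arm is pulled `o(T ^ γ)` times in expectation, for every
`0 < γ ≤ 1`. The policy may depend on the horizon: `π T` is the policy run for horizon `T`. -/
def IsConsistent {K : ℕ} (M : Set (ProbabilityMeasure ℝ)) (α : ℝ) (c : Fin K → ℝ)
    (π : ℕ → Policy K) : Prop :=
  ∀ ν : Instance K, (∀ i, ν i ∈ M) → ∀ a, IsOptimalArm α c ν a → ∀ i, i ≠ a →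
    ∀ γ : ℝ, 0 < γ → γ ≤ 1 →
      (fun T : ℕ => expectedPulls (π T) ν i T) =o[atTop] fun T : ℕ => (T : ℝ) ^ γ

/-- The least Kullback-Leibler divergence from `P` to a member of `M` with mean larger than `x`;
it is `∞` if there is no such member. -/
def Dinf (M : Set (ProbabilityMeasure ℝ)) (P : ProbabilityMeasure ℝ) (x : ℝ) : ℝ≥0∞ :=
  ⨅ (Q : ProbabilityMeasure ℝ) (_ : Q ∈ M) (_ : x < mean Q),
    InformationTheory.klDiv (P : Measure ℝ) (Q : Measure ℝ)

/-- The family of all Gaussian distributions with unit variance. -/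
def unitGaussians : Set (ProbabilityMeasure ℝ) :=
  Set.range fun m : ℝ => (⟨gaussianReal m 1, inferInstance⟩ : ProbabilityMeasure ℝ)

end CostSubsidy

end

/-! Change of measure. Let `a` be the optimal arm of `ν`, and replace `ν k` by `Q ∈ M` with mean
above `μ_a / (1 - α)`. In the new instance `ν'` arm `a` is infeasible and some other arm is optimal
(`exists_isOptimalArm_update`). By consistency the event that `a` gets more than `T / 2` pulls has
probability at least `1 - δ` under `ν` and at most `T ^ (δ - 1)` under `ν'`. Such an event costs
divergence at least `(1 - δ)² log T - 1` between the two history laws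
(`neg_measureReal_mul_log_le_toReal_klDiv`), while only pulls of `k` distinguish them, so the
divergence is at most `E_ν[n_k] · KL(ν k, Q)` (`klDiv_historyLaw_le`). Let `δ → 0` and vary `Q`. -/

namespace CostSubsidy

open InformationTheory

/-! ### Kullback-Leibler divergence -/

/-- Young's inequality for `klFun` and its convex conjugate `s ↦ exp s - 1`. -/
theorem mul_add_one_sub_exp_le_klFun {x : ℝ} (hx : 0 ≤ x) (s : ℝ) :
    s * x + (1 - Real.exp s) ≤ klFun x := by
  rw [klFun_apply]
  rcases hx.eq_or_lt with rfl | hx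
  · simpa using (Real.exp_pos s).le
  · have h := Real.add_one_le_exp (s - Real.log x)
    rw [Real.exp_sub, Real.exp_log hx, le_div_iff₀ hx] at h
    linarith

/-- An event which is likely under `μ` and unlikely under `ν` forces a large divergence. -/
theorem neg_measureReal_mul_log_le_toReal_klDiv {Ω : Type*} [MeasurableSpace Ω]
    {μ ν : Measure Ω} [IsProbabilityMeasure μ] [IsProbabilityMeasure ν]
    (h : klDiv μ ν ≠ ∞) (A : Set Ω) :
    -(μ.real A * Real.log (ν.real A)) ≤ (klDiv μ ν).toReal + 1 := by
  obtain ⟨hac, hint⟩ := klDiv_ne_top_iff.mp h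
  rcases (measureReal_nonneg (μ := ν) (s := A)).eq_or_lt with hq | hq
  -- Since `Real.log 0 = 0`, the left side vanishes here.
  · rw [← hq]; simp; positivity
  rw [toReal_klDiv_eq_integral_klFun hac]
  have hk := (integrable_klFun_rnDeriv_iff hac).mpr hint
  -- With `exp s = 1 / ν(A)`, the constant term integrates over `A` to `ν(A) - 1 ≥ -1`.
  set s : ℝ := -Real.log (ν.real A)
  have hr : Integrable (fun x => (μ.rnDeriv ν x).toReal) ν := Measure.integrable_toReal_rnDeriv
  have h1 : ∫ x in A, (s * (μ.rnDeriv ν x).toReal + (1 - Real.exp s)) ∂ν ≤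
      ∫ x in A, klFun (μ.rnDeriv ν x).toReal ∂ν :=
    integral_mono ((hr.restrict.const_mul s).add (integrable_const _)) hk.restrict
      fun x => mul_add_one_sub_exp_le_klFun ENNReal.toReal_nonneg s
  have h2 : ∫ x in A, klFun (μ.rnDeriv ν x).toReal ∂ν ≤ ∫ x, klFun (μ.rnDeriv ν x).toReal ∂ν :=
    setIntegral_le_integral hk (ae_of_all _ fun x => klFun_nonneg ENNReal.toReal_nonneg)
  rw [integral_add (hr.restrict.const_mul s) (integrable_const _), integral_const_mul,
    Measure.setIntegral_toReal_rnDeriv hac, setIntegral_const, smul_eq_mul] at h1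
  have h3 : ν.real A * Real.exp s = 1 := by
    rw [Real.exp_neg, Real.exp_log hq, mul_inv_cancel₀ hq.ne']
  have h4 : s * μ.real A = -(μ.real A * Real.log (ν.real A)) := by simp only [s]; ring
  nlinarith

/-- Conditional divergence is the average of the divergences between the kernels. -/
theorem klDiv_compProd_right {X Y : Type*} [MeasurableSpace X] [MeasurableSpace Y]
    [MeasurableSpace.CountableOrCountablyGenerated X Y]
    (m : Measure X) [IsFiniteMeasure m] (κ η : Kernel X Y) [IsFiniteKernel κ] [IsFiniteKernel η]
    (hac : ∀ x, κ x ≪ η x) :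
    klDiv (m ⊗ₘ κ) (m ⊗ₘ η) = ∫⁻ x, klDiv (κ x) (η x) ∂m := by
  have hκ : η.withDensity (κ.rnDeriv η) = κ := by
    ext1 x
    exact Kernel.withDensity_rnDeriv_eq (hac x)
  have hmeas : Measurable (Function.uncurry (κ.rnDeriv η)) := Kernel.measurable_rnDeriv κ η
  have hd : m ⊗ₘ κ = (m ⊗ₘ η).withDensity (fun p => κ.rnDeriv η p.1 p.2) := by
    rw [← Measure.compProd_withDensity hmeas, hκ]
  have hae : (m ⊗ₘ κ).rnDeriv (m ⊗ₘ η) =ᵐ[m ⊗ₘ η] fun p => κ.rnDeriv η p.1 p.2 := by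
    rw [hd]
    exact Measure.rnDeriv_withDensity _ hmeas
  have hacm : m ⊗ₘ κ ≪ m ⊗ₘ η := Measure.AbsolutelyContinuous.compProd_right (ae_of_all _ hac)
  -- As `klFun ≥ 0`, Tonelli applies even when the divergence is infinite.
  rw [klDiv_eq_lintegral_klFun_of_ac hacm,
    lintegral_congr_ae (g := fun p => ENNReal.ofReal (klFun (κ.rnDeriv η p.1 p.2).toReal))
      (hae.mono fun p hp => by simp only [hp]),
    Measure.lintegral_compProd]
  · refine lintegral_congr fun x => ?_
    rw [klDiv_eq_lintegral_klFun_of_ac (hac x)]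
    refine lintegral_congr_ae ?_
    filter_upwards [Kernel.rnDeriv_eq_rnDeriv_measure (κ := κ) (η := η) (a := x)] with y hy
    rw [hy]
  · exact (measurable_klFun.comp hmeas.ennreal_toReal).ennreal_ofReal

theorem gaussianReal_eq_withDensity (m m' : ℝ) :
    gaussianReal m 1 = (gaussianReal m' 1).withDensity
      (fun x => ENNReal.ofReal (Real.exp ((m - m') * x - (m ^ 2 - m' ^ 2) / 2))) := by
  rw [gaussianReal_of_var_ne_zero m one_ne_zero, gaussianReal_of_var_ne_zero m' one_ne_zero,
    ← withDensity_mul _ (measurable_gaussianPDF _ _) (by fun_prop)]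
  congr 1
  ext x
  simp only [gaussianPDF, gaussianPDFReal, Pi.mul_apply]
  rw [← ENNReal.ofReal_mul (by positivity), mul_assoc _ (Real.exp _) (Real.exp _), ← Real.exp_add]
  congr 3
  simp only [NNReal.coe_one]
  ring

/-- The log-likelihood ratio is affine, so only the mean of the first law enters. -/
theorem klDiv_gaussianReal (m m' : ℝ) :
    klDiv (gaussianReal m 1) (gaussianReal m' 1) = ENNReal.ofReal ((m - m') ^ 2 / 2) := by
  have hac : gaussianReal m 1 ≪ gaussianReal m' 1 :=
    (gaussianReal_absolutelyContinuous m one_ne_zero).trans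
      (gaussianReal_absolutelyContinuous' m' one_ne_zero)
  have hllr : llr (gaussianReal m 1) (gaussianReal m' 1) =ᵐ[gaussianReal m 1]
      fun x => (m - m') * x - (m ^ 2 - m' ^ 2) / 2 := by
    have h : (gaussianReal m 1).rnDeriv (gaussianReal m' 1) =ᵐ[gaussianReal m' 1]
        fun x => ENNReal.ofReal (Real.exp ((m - m') * x - (m ^ 2 - m' ^ 2) / 2)) := by
      conv_lhs => rw [gaussianReal_eq_withDensity m m']
      exact Measure.rnDeriv_withDensity _ (by fun_prop)
    filter_upwards [hac.ae_le h] with x hx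
    rw [llr, hx, ENNReal.toReal_ofReal (Real.exp_pos _).le, Real.log_exp]
  have hid : Integrable (fun x : ℝ => x) (gaussianReal m 1) :=
    (memLp_id_gaussianReal 1).integrable le_rfl
  have hi : Integrable (fun x => (m - m') * x - (m ^ 2 - m' ^ 2) / 2) (gaussianReal m 1) :=
    (hid.const_mul _).sub (integrable_const _)
  rw [klDiv_of_ac_of_integrable hac ((integrable_congr hllr).mpr hi), integral_congr_ae hllr,
    integral_sub (hid.const_mul _) (integrable_const _), integral_const_mul,
    integral_id_gaussianReal, integral_const]
  congr 1
  simp only [probReal_univ, smul_eq_mul]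
  ring

/-! ### Pull counts -/

theorem pulls_eq_sum {K t : ℕ} (k : Fin K) (h : History K t) :
    pulls k h = ∑ s, if (h s).1 = k then 1 else 0 :=
  Finset.card_filter _ _

theorem pulls_extend {K t : ℕ} (k : Fin K) (h : History K t) (p : Fin K × ℝ) :
    pulls k (History.extend (h, p)) = pulls k h + if p.1 = k then 1 else 0 := by
  simp only [pulls_eq_sum, Fin.sum_univ_castSucc, History.extend, Fin.snoc_castSucc,
    Fin.snoc_last]

theorem pulls_le {K t : ℕ} (k : Fin K) (h : History K t) : pulls k h ≤ t := by
  exact (Finset.card_filter_le _ _).trans (by simp)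

theorem sum_pulls {K t : ℕ} (h : History K t) : ∑ k, pulls k h = t := by
  simpa [pulls] using (Finset.card_eq_sum_card_fiberwise (s := (Finset.univ : Finset (Fin t)))
    (f := fun s => (h s).1) (t := Finset.univ) (by simp)).symm

theorem measurable_pulls {K t : ℕ} (k : Fin K) :
    Measurable (pulls k : History K t → ℕ) := by
  simp only [funext (pulls_eq_sum k)]
  refine Finset.measurable_sum _ fun s _ => ?_
  refine Measurable.ite ?_ measurable_const measurable_const
  exact (measurable_pi_apply s).fst (measurableSet_singleton k)

theorem integrable_pulls {K t : ℕ} (k : Fin K) (μ : Measure (History K t)) [IsFiniteMeasure μ] :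
    Integrable (fun h => (pulls k h : ℝ)) μ := by
  refine Integrable.of_bound (measurable_from_nat.comp (measurable_pulls k)).aestronglyMeasurable
    (t : ℝ) (ae_of_all _ fun h => ?_)
  simpa using pulls_le k h

theorem lintegral_pulls {K : ℕ} (π : Policy K) (ν : Instance K) (k : Fin K) (T : ℕ) :
    ∫⁻ h, (pulls k h : ℝ≥0∞) ∂(historyLaw π ν T) = ENNReal.ofReal (expectedPulls π ν k T) := by
  rw [expectedPulls, ofReal_integral_eq_lintegral_ofReal (integrable_pulls k _)
    (ae_of_all _ fun h => Nat.cast_nonneg _)]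
  simp

theorem expectedPulls_nonneg {K : ℕ} (π : Policy K) (ν : Instance K) (k : Fin K) (T : ℕ) :
    0 ≤ expectedPulls π ν k T :=
  integral_nonneg fun _ => Nat.cast_nonneg _

theorem sum_expectedPulls {K : ℕ} (π : Policy K) (ν : Instance K) (T : ℕ) :
    ∑ k, expectedPulls π ν k T = T := by
  simp only [expectedPulls]
  rw [← integral_finsetSum _ fun k _ => integrable_pulls k _]
  simp [← Nat.cast_sum, sum_pulls]

theorem lintegral_pulls_succ {K : ℕ} (π : Policy K) (ν : Instance K) (k : Fin K) (t : ℕ) :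
    ∫⁻ h, (pulls k h : ℝ≥0∞) ∂(historyLaw π ν (t + 1)) =
      ∫⁻ h, (pulls k h : ℝ≥0∞) ∂(historyLaw π ν t) +
        ∫⁻ h, π.rule t h {k} ∂(historyLaw π ν t) := by
  have hm (s : ℕ) : Measurable fun h : History K s => (pulls k h : ℝ≥0∞) :=
    measurable_from_nat.comp (measurable_pulls k)
  rw [historyLaw, lintegral_map (hm _) History.measurable_extend,
    Measure.lintegral_compProd (f := fun p => (pulls k (History.extend p) : ℝ≥0∞))
      ((hm _).comp History.measurable_extend), ← lintegral_add_left (hm _)]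
  refine lintegral_congr fun h => ?_
  have hk : MeasurableSet {p : Fin K × ℝ | p.1 = k} := measurable_fst (measurableSet_singleton k)
  simp only [pulls_extend, Nat.cast_add]
  rw [lintegral_add_left measurable_const]
  congr 1
  · simp
  · have : (fun p : Fin K × ℝ => (((if p.1 = k then 1 else 0 : ℕ)) : ℝ≥0∞)) =
        Set.indicator {p : Fin K × ℝ | p.1 = k} 1 := by
      ext p; by_cases hp : p.1 = k <;> simp [hp]
    rw [this, lintegral_indicator_one hk, roundKernel]
    have h2 := Kernel.fst_compProd (π.rule t) ((rewardKernel ν).prodMkLeft (History K t))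
    rw [← congrArg (fun κ => κ h {k}) h2, Kernel.fst_apply' _ _ (measurableSet_singleton k)]
    rfl

/-! ### Comparing history laws -/

/-- **Divergence decomposition**: if two instances differ only in arm `k`, the divergence between
the laws of the histories is at most the expected number of pulls of `k` times the divergence
between its reward distributions. -/
theorem klDiv_historyLaw_le {K : ℕ} (π : Policy K) (ν ν' : Instance K) (k : Fin K)
    (hν : ∀ i, i ≠ k → ν' i = ν i) (hac : (ν k : Measure ℝ) ≪ (ν' k : Measure ℝ)) (T : ℕ) :
    klDiv (historyLaw π ν T) (historyLaw π ν' T) ≤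
      (∫⁻ h, (pulls k h : ℝ≥0∞) ∂(historyLaw π ν T)) *
        klDiv (ν k : Measure ℝ) (ν' k : Measure ℝ) := by
  induction T with
  | zero => simp [historyLaw]
  | succ t ih =>
    rw [lintegral_pulls_succ, add_mul]
    calc klDiv (historyLaw π ν (t + 1)) (historyLaw π ν' (t + 1))
        ≤ klDiv (historyLaw π ν t ⊗ₘ roundKernel π ν t)
            (historyLaw π ν' t ⊗ₘ roundKernel π ν' t) :=
          klDiv_map_le _ _ History.measurable_extend
      _ = klDiv (historyLaw π ν t) (historyLaw π ν' t) +
            klDiv (historyLaw π ν t ⊗ₘ roundKernel π ν t)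
              (historyLaw π ν t ⊗ₘ roundKernel π ν' t) := klDiv_compProd_eq_add _ _ _ _
      _ ≤ _ := add_le_add ih ?_
    -- Grouped this way, history and arm have the same law on both sides, so the policy's
    -- randomization adds no divergence; only the rewards differ.
    have hcond (κ : Instance K) : historyLaw π ν t ⊗ₘ roundKernel π κ t =
        ((historyLaw π ν t ⊗ₘ π.rule t) ⊗ₘ (rewardKernel κ).prodMkLeft (History K t)).map
          MeasurableEquiv.prodAssoc := by
      rw [roundKernel, Measure.compProd_assoc']
    rw [hcond, hcond]
    refine (klDiv_map_le _ _ MeasurableEquiv.prodAssoc.measurable).trans ?_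
    have hacx (a : Fin K) : rewardKernel ν a ≪ rewardKernel ν' a := by
      change (ν a : Measure ℝ) ≪ (ν' a : Measure ℝ)
      by_cases ha : a = k
      · rwa [ha]
      · rw [hν a ha]
    rw [klDiv_compProd_right _ _ _ fun x => by simpa using hacx x.2]
    have hval (x : History K t × Fin K) :
        klDiv ((rewardKernel ν).prodMkLeft (History K t) x)
          ((rewardKernel ν').prodMkLeft (History K t) x) =
        ({k} : Set (Fin K)).indicator
          (fun _ => klDiv (ν k : Measure ℝ) (ν' k : Measure ℝ)) x.2 := by
      change klDiv (ν x.2 : Measure ℝ) (ν' x.2 : Measure ℝ) = _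
      by_cases ha : x.2 = k
      · simp [ha]
      · simp [ha, hν _ ha]
    simp only [hval]
    have hm : Measurable fun x : History K t × Fin K => ({k} : Set (Fin K)).indicator
        (fun _ => klDiv (ν k : Measure ℝ) (ν' k : Measure ℝ)) x.2 :=
      (measurable_const.indicator (measurableSet_singleton k)).comp measurable_snd
    rw [Measure.lintegral_compProd hm,
      ← lintegral_mul_const _ ((π.rule t).measurable_coe (measurableSet_singleton k))]
    refine (lintegral_congr fun h => ?_).le
    rw [lintegral_indicator_const (measurableSet_singleton k), mul_comm]

theorem measureReal_lt_pulls_le {K : ℕ} (π : Policy K) (ν : Instance K) (a : Fin K) {T : ℕ}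
    (hT : 0 < T) :
    (historyLaw π ν T).real {h | (T : ℝ) / 2 < pulls a h} ≤ 2 * expectedPulls π ν a T / T := by
  have hT' : (0 : ℝ) < T := by exact_mod_cast hT
  have h := mul_meas_ge_le_integral_of_nonneg (μ := historyLaw π ν T)
    (ae_of_all _ fun h => Nat.cast_nonneg (pulls a h)) (integrable_pulls a _) ((T : ℝ) / 2)
  have h2 : (historyLaw π ν T).real {h | (T : ℝ) / 2 < pulls a h} ≤
      (historyLaw π ν T).real {h | (T : ℝ) / 2 ≤ pulls a h} :=
    measureReal_mono fun h (hh : (T : ℝ) / 2 < pulls a h) => hh.le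
  rw [le_div_iff₀ hT']
  change _ ≤ expectedPulls π ν a T at h
  nlinarith

/-- Markov's inequality for `T - pulls a`, the number of pulls of the other arms. -/
theorem one_sub_le_measureReal_lt_pulls {K : ℕ} (π : Policy K) (ν : Instance K) (a : Fin K)
    {T : ℕ} (hT : 0 < T) :
    1 - 2 * (∑ i ∈ Finset.univ.erase a, expectedPulls π ν i T) / T ≤
      (historyLaw π ν T).real {h | (T : ℝ) / 2 < pulls a h} := by
  have hT' : (0 : ℝ) < T := by exact_mod_cast hT
  have hA : MeasurableSet {h : History K T | (T : ℝ) / 2 < pulls a h} :=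
    measurableSet_lt measurable_const (measurable_from_nat.comp (measurable_pulls a))
  have hsum := sum_expectedPulls π ν T
  rw [← Finset.add_sum_erase _ _ (Finset.mem_univ a)] at hsum
  have hint : Integrable (fun h => (T : ℝ) - pulls a h) (historyLaw π ν T) :=
    (integrable_const _).sub (integrable_pulls a _)
  have h := mul_meas_ge_le_integral_of_nonneg
    (ae_of_all _ fun h => sub_nonneg.mpr (by exact_mod_cast pulls_le a h)) hint ((T : ℝ) / 2)
  rw [integral_sub (integrable_const _) (integrable_pulls a _), integral_const, probReal_univ,
    one_smul] at h
  change _ ≤ (T : ℝ) - expectedPulls π ν a T at h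
  have h2 : (historyLaw π ν T).real {h | (T : ℝ) / 2 < pulls a h}ᶜ ≤
      (historyLaw π ν T).real {h | (T : ℝ) / 2 ≤ T - pulls a h} := by
    refine measureReal_mono fun h hh => ?_
    have : ¬ (T : ℝ) / 2 < pulls a h := hh
    change (T : ℝ) / 2 ≤ T - pulls a h
    linarith
  rw [probReal_compl_eq_one_sub hA] at h2
  rw [sub_le_iff_le_add, ← sub_le_iff_le_add', le_div_iff₀ hT']
  nlinarith

/-! ### The lower bound -/

/-- Raising the mean of arm `k` above `μ_a / (1 - α)` moves the optimal arm away from `a`. -/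
theorem exists_isOptimalArm_update {K : ℕ} {α : ℝ} (hα0 : 0 ≤ α) (hα1 : α < 1) {c : Fin K → ℝ}
    (hc : Monotone c) {ν : Instance K} {a k : Fin K} (hak : a ≠ k) (ha : IsFeasible α ν a)
    {Q : ProbabilityMeasure ℝ} (hQ : mean (ν a) / (1 - α) < mean Q) :
    ∃ b, b ≠ a ∧ IsOptimalArm α c (Function.update ν k Q) b := by
  set ν' := Function.update ν k Q with hν'
  have hα : 0 < 1 - α := sub_pos.mpr hα1
  have hle (ν : Instance K) (i : Fin K) : mean (ν i) ≤ bestMean ν :=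
    le_ciSup (f := fun i => mean (ν i)) (Set.finite_range _).bddAbove i
  have hk : mean Q ≤ bestMean ν' := by simpa [hν'] using hle ν' k
  have hbest : mean (ν a) < (1 - α) * bestMean ν' := by
    rw [mul_comm]
    exact (div_lt_iff₀ hα).mp (hQ.trans_le hk)
  have ha' : ¬ IsFeasible α ν' a := by
    rw [IsFeasible, hν', Function.update_of_ne hak, not_le]
    exact hbest
  -- Means may be negative, and the best arm is feasible only if `α * bestMean ≥ 0`. This holds for
  -- `ν` because `a` is feasible, and passes to the larger `bestMean ν'`.
  have hpos : 0 ≤ α * bestMean ν' := by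
    have h1 : 0 ≤ α * bestMean ν := by
      have := hle ν a
      unfold IsFeasible at ha
      linarith
    have h2 : bestMean ν < bestMean ν' := lt_of_mul_lt_mul_left (ha.trans_lt hbest) hα.le
    nlinarith
  have : Nonempty (Fin K) := ⟨a⟩
  obtain ⟨j, hj⟩ := exists_eq_ciSup_of_finite (f := fun i => mean (ν' i))
  have hfj : IsFeasible α ν' j := by
    change mean (ν' j) = bestMean ν' at hj
    rw [IsFeasible, hj]
    linarith
  obtain ⟨b, hb, hmin⟩ := wellFounded_lt.has_min {i | IsFeasible α ν' i} ⟨j, hfj⟩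
  refine ⟨b, fun h => ha' (h ▸ hb), hb, fun i hi => ?_⟩
  have hbi : b ≤ i := not_lt.mp (hmin i hi)
  exact ⟨hc hbi, fun _ => hbi⟩

/-- The change of measure from `ν k` to `Q`. -/
theorem eventually_mul_log_le_expectedPulls {K : ℕ} {α : ℝ} (hα0 : 0 ≤ α) (hα1 : α < 1)
    {c : Fin K → ℝ} (hc : Monotone c) {π : ℕ → Policy K} {M : Set (ProbabilityMeasure ℝ)}
    (hπ : IsConsistent M α c π) {ν : Instance K} (hν : ∀ i, ν i ∈ M) {a k : Fin K}
    (ha : IsOptimalArm α c ν a) (hak : a ≠ k) {Q : ProbabilityMeasure ℝ} (hQM : Q ∈ M)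
    (hQ : mean (ν a) / (1 - α) < mean Q)
    (hkl : klDiv (ν k : Measure ℝ) (Q : Measure ℝ) ≠ ∞) {r : ℝ} (hr0 : 0 ≤ r)
    (hr : r * (klDiv (ν k : Measure ℝ) (Q : Measure ℝ)).toReal < 1) :
    ∀ᶠ T : ℕ in atTop, r * Real.log T ≤ expectedPulls (π T) ν k T := by
  obtain ⟨b, hba, hb⟩ := exists_isOptimalArm_update hα0 hα1 hc hak ha.1 hQ
  set ν' : Instance K := Function.update ν k Q with hν'
  have hν'M : ∀ i, ν' i ∈ M := by
    intro i
    by_cases hi : i = k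
    · simpa [hi, hν'] using hQM
    · simpa [hi, hν'] using hν i
  have hν'k : ν' k = Q := by simp [hν']
  set D : ℝ := (klDiv (ν k : Measure ℝ) (Q : Measure ℝ)).toReal with hD
  have hD0 : 0 ≤ D := ENNReal.toReal_nonneg
  have hrD0 : 0 ≤ r * D := mul_nonneg hr0 hD0
  -- Then `(1 - δ)² - r D = 2 δ + δ²`, so the final contradiction only needs `2 δ log T > 1`.
  obtain ⟨δ, hδ⟩ : ∃ δ, δ = (1 - r * D) / 4 := ⟨_, rfl⟩
  have hδ0 : 0 < δ := by linarith
  have hδ1 : δ ≤ 1 / 4 := by linarith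
  have hlog : ∀ᶠ T : ℕ in atTop, 1 / (2 * δ) < Real.log T :=
    (Real.tendsto_log_atTop.comp tendsto_natCast_atTop_atTop).eventually_gt_atTop _
  have hsmall : ∀ᶠ T : ℕ in atTop, expectedPulls (π T) ν' a T ≤ 1 / 2 * (T : ℝ) ^ δ := by
    filter_upwards [(hπ ν' hν'M b hb a hba.symm δ hδ0 (by linarith)).def
      (by norm_num : (0 : ℝ) < 1 / 2)] with T hT
    rwa [Real.norm_of_nonneg (expectedPulls_nonneg _ _ _ _),
      Real.norm_of_nonneg (by positivity)] at hT
  have hothers : ∀ᶠ T : ℕ in atTop,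
      ∑ i ∈ Finset.univ.erase a, expectedPulls (π T) ν i T ≤ δ / 2 * T := by
    have h : (fun T : ℕ => ∑ i ∈ Finset.univ.erase a, expectedPulls (π T) ν i T)
        =o[atTop] fun T : ℕ => (T : ℝ) ^ (1 : ℝ) := by
      simpa only [Finset.sum_fn] using IsLittleO.sum fun i hi =>
        hπ ν hν a ha i (Finset.ne_of_mem_erase hi) 1 one_pos le_rfl
    filter_upwards [h.def (half_pos hδ0)] with T hT
    rw [Real.rpow_one, Real.norm_of_nonneg (Nat.cast_nonneg T)] at hT
    exact (Real.le_norm_self _).trans hT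
  filter_upwards [hlog, hsmall, hothers, eventually_gt_atTop 0] with T hlog hsmall hothers hT
  have hT' : (0 : ℝ) < T := by exact_mod_cast hT
  have hlog0 : 0 < Real.log T := lt_trans (by positivity) hlog
  set P := historyLaw (π T) ν T
  set P' := historyLaw (π T) ν' T
  set A : Set (History K T) := {h | (T : ℝ) / 2 < pulls a h}
  have hacQ : (ν k : Measure ℝ) ≪ (ν' k : Measure ℝ) := by
    rw [hν'k]; exact (klDiv_ne_top_iff.mp hkl).1
  have hKL := klDiv_historyLaw_le (π T) ν ν' k
    (fun i hi => by simp [hν', hi]) hacQ T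
  rw [lintegral_pulls, hν'k] at hKL
  have hfin : ENNReal.ofReal (expectedPulls (π T) ν k T) *
      klDiv (ν k : Measure ℝ) (Q : Measure ℝ) ≠ ∞ := ENNReal.mul_ne_top ENNReal.ofReal_ne_top hkl
  have hKLtop : klDiv P P' ≠ ∞ := ne_top_of_le_ne_top hfin hKL
  have hKLreal : (klDiv P P').toReal ≤ expectedPulls (π T) ν k T * D := by
    have := ENNReal.toReal_mono hfin hKL
    rwa [ENNReal.toReal_mul, ENNReal.toReal_ofReal (expectedPulls_nonneg _ _ _ _)] at this
  have hp : 1 - δ ≤ P.real A := by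
    refine le_trans ?_ (one_sub_le_measureReal_lt_pulls (π T) ν a hT)
    have : 2 * (∑ i ∈ Finset.univ.erase a, expectedPulls (π T) ν i T) / T ≤ δ := by
      rw [div_le_iff₀ hT']; linarith
    linarith
  have hq : P'.real A ≤ (T : ℝ) ^ (δ - 1) := by
    refine (measureReal_lt_pulls_le (π T) ν' a hT).trans ?_
    rw [Real.rpow_sub_one hT'.ne']
    gcongr
    linarith
  -- Needed to take logarithms: a null event under `P'` would be null under `P`.
  have hq0 : 0 < P'.real A := by
    refine measureReal_nonneg.lt_of_ne' fun h0 => ?_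
    have h1 : P A = 0 := (klDiv_ne_top_iff.mp hKLtop).1 ((measureReal_eq_zero_iff).mp h0)
    have h2 : P.real A = 0 := (measureReal_eq_zero_iff).mpr h1
    linarith
  have hlogq : Real.log (P'.real A) ≤ (δ - 1) * Real.log T := by
    rw [← Real.log_rpow hT']
    exact Real.log_le_log hq0 hq
  have hmain := neg_measureReal_mul_log_le_toReal_klDiv hKLtop A
  have h1 : (1 - δ) * ((1 - δ) * Real.log T) ≤ -(P.real A * Real.log (P'.real A)) := by
    rw [← mul_neg]
    refine mul_le_mul hp (by linarith) (mul_nonneg (by linarith) hlog0.le) measureReal_nonneg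
  by_contra! hlt
  have h2 : expectedPulls (π T) ν k T * D ≤ r * Real.log T * D := by gcongr
  have h3 : 1 < Real.log T * (2 * δ) := (div_lt_iff₀ (by positivity)).mp hlog
  have h4 : r * D = 1 - 4 * δ := by linarith
  have h5 : r * Real.log T * D = (1 - 4 * δ) * Real.log T := by rw [← h4]; ring
  nlinarith [mul_nonneg (sq_nonneg δ) hlog0.le]

theorem one_div_Dinf_le_liminf {K : ℕ} {α : ℝ} (hα0 : 0 ≤ α) (hα1 : α < 1)
    {c : Fin K → ℝ} (hc : Monotone c) {π : ℕ → Policy K} {M : Set (ProbabilityMeasure ℝ)}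
    (hπ : IsConsistent M α c π) {ν : Instance K} (hν : ∀ i, ν i ∈ M) {a k : Fin K}
    (ha : IsOptimalArm α c ν a) (hak : a ≠ k) :
    1 / Dinf M (ν k) (mean (ν a) / (1 - α)) ≤
      liminf (fun T : ℕ => ENNReal.ofReal (expectedPulls (π T) ν k T / Real.log T)) atTop := by
  -- The infimum need not be attained: each `r < 1 / Dinf` yields its own `Q` with `r * KL < 1`.
  refine le_of_forall_lt_imp_le_of_dense fun r hr => ?_
  rw [one_div, ENNReal.lt_inv_iff_lt_inv] at hr
  simp only [Dinf, iInf_lt_iff] at hr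
  obtain ⟨Q, hQM, hQ, hlt⟩ := hr
  rcases eq_or_ne r 0 with rfl | hr0
  · exact zero_le
  have hrtop : r ≠ ∞ := by
    rintro rfl
    simp at hlt
  have hkl : klDiv (ν k : Measure ℝ) (Q : Measure ℝ) ≠ ∞ := hlt.ne_top
  have hmul : r.toReal * (klDiv (ν k : Measure ℝ) (Q : Measure ℝ)).toReal < 1 := by
    rw [← ENNReal.toReal_mul, ← ENNReal.toReal_one]
    refine (ENNReal.toReal_lt_toReal (ENNReal.mul_ne_top hrtop hkl) ENNReal.one_ne_top).mpr ?_
    calc r * klDiv (ν k : Measure ℝ) (Q : Measure ℝ) < r * r⁻¹ :=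
          (ENNReal.mul_lt_mul_iff_right hr0 hrtop).mpr hlt
      _ = 1 := ENNReal.mul_inv_cancel hr0 hrtop
  refine le_liminf_of_le (by isBoundedDefault) ?_
  filter_upwards [eventually_mul_log_le_expectedPulls hα0 hα1 hc hπ hν ha hak hQM hQ hkl
    ENNReal.toReal_nonneg hmul, eventually_gt_atTop 1] with T hT hT1
  rw [← ENNReal.ofReal_toReal hrtop]
  refine ENNReal.ofReal_le_ofReal ?_
  rwa [le_div_iff₀ (Real.log_pos (by exact_mod_cast hT1))]

/-! ### Unit-variance Gaussians -/

theorem mean_le_div_of_isFeasible {K : ℕ} {α : ℝ} (hα1 : α < 1) {ν : Instance K} {a : Fin K}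
    (ha : IsFeasible α ν a) (k : Fin K) : mean (ν k) ≤ mean (ν a) / (1 - α) := by
  rw [le_div_iff₀ (sub_pos.mpr hα1), mul_comm]
  exact (mul_le_mul_of_nonneg_left (le_ciSup (f := fun i => mean (ν i))
    (Set.finite_range _).bddAbove k) (sub_pos.mpr hα1).le).trans ha

/-- The constraint is strict, so the value is only approached, by means `y ↓ x`. For `y > x ≥ mean
P` the divergence increases with `y`, whence the lower bound. -/
theorem Dinf_unitGaussians {P : ProbabilityMeasure ℝ} (hP : P ∈ unitGaussians) {x : ℝ}
    (hx : mean P ≤ x) : Dinf unitGaussians P x = ENNReal.ofReal ((x - mean P) ^ 2 / 2) := by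
  have hmean (m : ℝ) : mean ⟨gaussianReal m 1, inferInstance⟩ = m := integral_id_gaussianReal
  obtain ⟨m, rfl⟩ := hP
  simp only [hmean] at hx ⊢
  refine le_antisymm ?_ ?_
  · have hlim : Tendsto (fun y : ℝ => ENNReal.ofReal ((m - y) ^ 2 / 2)) (nhdsWithin x (Set.Ioi x))
        (nhds (ENNReal.ofReal ((m - x) ^ 2 / 2))) := by
      refine Tendsto.mono_left (Continuous.tendsto ?_ x) nhdsWithin_le_nhds
      exact ENNReal.continuous_ofReal.comp (by fun_prop)
    rw [← neg_sub m x, neg_sq]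
    refine ge_of_tendsto hlim ?_
    filter_upwards [self_mem_nhdsWithin] with y hy
    rw [← klDiv_gaussianReal]
    exact iInf₂_le_of_le ⟨gaussianReal y 1, inferInstance⟩ ⟨y, rfl⟩
      (iInf_le_of_le (by rw [hmean]; exact hy) le_rfl)
  · refine le_iInf fun Q => le_iInf fun hQ => le_iInf fun hxQ => ?_
    obtain ⟨y, rfl⟩ := hQ
    rw [hmean] at hxQ
    change _ ≤ klDiv (gaussianReal m 1) (gaussianReal y 1)
    rw [klDiv_gaussianReal]
    refine ENNReal.ofReal_le_ofReal ?_
    nlinarith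

theorem one_div_Dinf_unitGaussians {K : ℕ} {α : ℝ} (hα1 : α < 1) {ν : Instance K}
    (hν : ∀ i, ν i ∈ unitGaussians) {a : Fin K} (ha : IsFeasible α ν a) (k : Fin K) :
    1 / Dinf unitGaussians (ν k) (mean (ν a) / (1 - α)) =
      ENNReal.ofReal (2 * (1 - α) ^ 2) /
        ENNReal.ofReal ((mean (ν a) - (1 - α) * mean (ν k)) ^ 2) := by
  have hα : 0 < 1 - α := sub_pos.mpr hα1
  rw [Dinf_unitGaussians (hν k) (mean_le_div_of_isFeasible hα1 ha k)]
  have hpos : 0 < 2 * (1 - α) ^ 2 := by positivity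
  have h : (mean (ν a) / (1 - α) - mean (ν k)) ^ 2 / 2 =
      (mean (ν a) - (1 - α) * mean (ν k)) ^ 2 / (2 * (1 - α) ^ 2) := by
    field_simp
  -- The square may vanish; both sides are then `∞`.
  rw [h, ENNReal.ofReal_div_of_pos hpos, one_div, ENNReal.inv_div]
  · exact Or.inl ENNReal.ofReal_ne_top
  · exact Or.inl (ENNReal.ofReal_pos.mpr hpos).ne'

end CostSubsidy

theorem theorem2 {K : ℕ} (α : ℝ) (hα0 : 0 ≤ α) (hα1 : α < 1)
    (c : Fin K → ℝ) (hc : Monotone c) (π : ℕ → CostSubsidy.Policy K) :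
    (∀ M : Set (ProbabilityMeasure ℝ),
      (∀ P ∈ M, Integrable (fun x : ℝ => x) (P : Measure ℝ)) →
      CostSubsidy.IsConsistent M α c π →
      ∀ ν : CostSubsidy.Instance K, (∀ i, ν i ∈ M) →
      ∀ a, CostSubsidy.IsOptimalArm α c ν a → ∀ k, a < k →
        1 / CostSubsidy.Dinf M (ν k) (CostSubsidy.mean (ν a) / (1 - α)) ≤
          liminf (fun T : ℕ => ENNReal.ofReal
            (CostSubsidy.expectedPulls (π T) ν k T / Real.log T)) atTop) ∧
    (∀ ν : CostSubsidy.Instance K, (∀ i, ν i ∈ CostSubsidy.unitGaussians) →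
      ∀ a, CostSubsidy.IsOptimalArm α c ν a → ∀ k, a < k →
        1 / CostSubsidy.Dinf CostSubsidy.unitGaussians (ν k)
            (CostSubsidy.mean (ν a) / (1 - α)) =
          ENNReal.ofReal (2 * (1 - α) ^ 2) / ENNReal.ofReal
            ((CostSubsidy.mean (ν a) - (1 - α) * CostSubsidy.mean (ν k)) ^ 2) ∧
        (CostSubsidy.IsConsistent CostSubsidy.unitGaussians α c π →
          ENNReal.ofReal (2 * (1 - α) ^ 2) / ENNReal.ofReal
              ((CostSubsidy.mean (ν a) - (1 - α) * CostSubsidy.mean (ν k)) ^ 2) ≤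
            liminf (fun T : ℕ => ENNReal.ofReal
              (CostSubsidy.expectedPulls (π T) ν k T / Real.log T)) atTop)) := by
  refine ⟨fun M _ hπ ν hν a ha k hak =>
    CostSubsidy.one_div_Dinf_le_liminf hα0 hα1 hc hπ hν ha hak.ne, fun ν hν a ha k hak => ?_⟩
  have h := CostSubsidy.one_div_Dinf_unitGaussians hα1 hν ha.1 k
  exact ⟨h, fun hπ => h ▸ CostSubsidy.one_div_Dinf_le_liminf hα0 hα1 hc hπ hν ha hak.ne⟩
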